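/- **Setting.** Let $G$ be a second countable locally compact Hausdorff groupoid with unit space $G^0$, range and source maps $r,s$, and a left Haar system $u\mapsto\lambda^u$ on the fibers $G^u=r^{-1}(u)$; write $G_u=s^{-1}(u)$ and $D=C_0(G^0)$. Inner products are conjugate linear in the first variable. A $G$-Hilbert bundle is a continuous field $\mathfrak H=\{\mathfrak H^u\}_{u\in G^0}$ of separable Hilbert spaces with surjective linear isometries $L_x:\mathfrak H^{s(x)}\to\mathfrak H^{r(x)}$ $(x\in G)$ such that $L_{xy}=L_xL_y$ whenever $s(x)=r(y)$ and such that, for all bounded continuous sections $\xi,\eta$, the coefficient $(\xi,\eta)(x)=\langle L_x\xi(s(x)),\eta(r(x))\rangle$ is continuous on $G$. $B(G)$ is the algebra of all such coefficients, over all $G$-Hilbert bundles, with norm $\|\phi\|=\inf\{\sup_u\|\xi(u)\|\,\sup_u\|\eta(u)\|:\phi=(\xi,\eta)\}$. For $f,g\in C_c(G)$ let $(f*g)(x)=\int f(t)g(t^{-1}x)\,d\lambda^{r(x)}(t)$ and $f^*(x)=\overline{f(x^{-1})}$. Let $A_{cf}(G)=\{g*f^*: f,g\in C_c(G)\}$ (the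 coefficients, with $f,g\in C_c(G)$, of the left regular bundle $\{L^2(G^u)\}$), let $A_{cf}(V)$ be the set of those elements of $A_{cf}(G)$ whose support lies in the open set $V$, and let $A_c(G)$ be the algebra generated by $A_{cf}(G)$ under pointwise operations. The Fourier algebra $A(G)$ is the closure of $A_c(G)$ in $B(G)$. Let $E^2$ be the Hilbert $D$-module of continuous sections vanishing at infinity of the bundle $\{L^2(G^u)\}$, with norm $\|F\|=\sup_u\|F^u\|$ and inner product $\langle F,F'\rangle(u)=\langle F^u,F'^u\rangle$; each $f\in C_c(G)$ is regarded as the section $u\mapsto f|_{G^u}$. Let $\mathcal A(G)\subset A(G)$ be the space of functions $\phi=\sum_n g_n*f_n^*$ with $f_n,g_n\in C_c(G)$ and $\sum_n\|f_n\|\,\|g_n\|<\infty$, with norm $\|\phi\|_1=\inf\sum_n\|f_n\|\,\|g_n\|$. Let $\mathcal A_K^r(G)'$ be the set of bounded linear right $D$-module maps $\alpha:\mathcal A(G)\to D$ such that for each $f\in C_c(G)$ the map $g\mapsto\alpha(g*f)$ on $C_c(G)$ extends to a compact map $E^2\to D$, i.e. to a norm limit of finite sums of maps $F\mapsto b\,\langle\xi,F\rangle$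 with $b\in D$, $\xi\in E^2$. The right and left actions of $b\in D$ on functions are $(\phi b)(x)=\phi(x)b(r(x))$ and $(b\phi)(x)=b(s(x))\phi(x)$. A *multiplicative module map* on $A(G)$ is a pair $(\alpha,\beta)$ of bounded linear maps $A(G)\to D$ such that: (i) $\alpha$ is a right and $\beta$ a left $D$-module map; (ii) for every $u\in G^0$ there is $\phi\in A(G)$ with $\alpha(\phi)(u)\neq0$; (iii) there is a homeomorphism $J$ of $G^0$ with $\beta(\phi)\circ J=\alpha(\phi)$ for all $\phi\in A(G)$; (iv) $\alpha|_{\mathcal A(G)}\in\mathcal A_K^r(G)'$; (v) $\alpha$ is multiplicative. **Proposition 25.** Let $(\alpha,\beta)$ be a multiplicative module map on $A(G)$. Then, for every $u\in G^0$, there is exactly one point $\gamma(u)\in G^u$ such that for each open neighborhood $V$ of $\gamma(u)$ there exists $\phi\in A_{cf}(V)$ with $\alpha(\phi)(u)\neq0$; and there is exactly one point $\delta(u)\in G_u$ such that for each open neighborhood $V$ of $\delta(u)$ there exists $\phi\in A_{cf}(V)$ with $\beta(\phi)(u)\neq0$. The maps $\gamma,\delta:G^0\to G$ so defined have the same range $B$.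 This $B$ is a bisection of $G$, that is, $r|_B$ and $s|_B$ are homeomorphisms of $B$ onto $G^0$, and $\gamma=(r|_B)^{-1}$ and $\delta=(s|_B)^{-1}$. -/

import Mathlib

open MeasureTheory Topology
open scoped CompactlySupported ZeroAtInfty ComplexConjugate

universe u v

noncomputable section

/-! ### Topological groupoids and Haar systems -/

/-- A topological groupoid with space of arrows `G` and space of units `X` (the unit space `G⁰`
is the image of `X` under `unit`, which is a homeomorphism onto its image because `r ∘ unit = id`).
The product `x y` is meaningful exactly when `s x = r y`; the total function `mul` has arbitrary
values on the other pairs, and no axiom mentions these values. -/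
structure TopGroupoid (G : Type u) (X : Type v) [TopologicalSpace G] [TopologicalSpace X] where
  r : G → X
  s : G → X
  unit : X → G
  inv : G → G
  mul : G → G → G
  r_unit : ∀ a, r (unit a) = a
  s_unit : ∀ a, s (unit a) = a
  r_inv : ∀ x, r (inv x) = s x
  s_inv : ∀ x, s (inv x) = r x
  r_mul : ∀ x y, s x = r y → r (mul x y) = r x
  s_mul : ∀ x y, s x = r y → s (mul x y) = s y
  mul_assoc : ∀ x y z, s x = r y → s y = r z → mul (mul x y) z = mul x (mul y z)
  unit_mul : ∀ x, mul (unit (r x)) x = x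
  mul_unit : ∀ x, mul x (unit (s x)) = x
  mul_inv : ∀ x, mul x (inv x) = unit (r x)
  inv_mul : ∀ x, mul (inv x) x = unit (s x)
  continuous_r : Continuous r
  continuous_s : Continuous s
  continuous_unit : Continuous unit
  continuous_inv : Continuous inv
  continuous_mul : ContinuousOn (fun p : G × G => mul p.1 p.2) {p | s p.1 = r p.2}

section Groupoid

variable {G : Type u} {X : Type v} [TopologicalSpace G] [TopologicalSpace X]

namespace TopGroupoid

variable (𝒢 : TopGroupoid G X)

theorem inv_inv (x : G) : 𝒢.inv (𝒢.inv x) = x := by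
  have h1 : 𝒢.mul (𝒢.mul (𝒢.inv (𝒢.inv x)) (𝒢.inv x)) x = x := by
    rw [𝒢.inv_mul, 𝒢.s_inv, 𝒢.unit_mul]
  have h2 : 𝒢.mul (𝒢.mul (𝒢.inv (𝒢.inv x)) (𝒢.inv x)) x = 𝒢.inv (𝒢.inv x) := by
    rw [𝒢.mul_assoc _ _ _ (by rw [𝒢.s_inv]) (by rw [𝒢.s_inv]), 𝒢.inv_mul]
    have := 𝒢.mul_unit (𝒢.inv (𝒢.inv x))
    rwa [𝒢.s_inv, 𝒢.r_inv] at this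
  exact h2.symm.trans h1

/-- The inversion as a homeomorphism of `G`. -/
def invHomeo : G ≃ₜ G where
  toFun := 𝒢.inv
  invFun := 𝒢.inv
  left_inv := 𝒢.inv_inv
  right_inv := 𝒢.inv_inv
  continuous_toFun := 𝒢.continuous_inv
  continuous_invFun := 𝒢.continuous_inv

/-- The involution `f*(x) = conj (f (x⁻¹))` on `C_c(G)`. -/
def ccStar (f : C_c(G, ℂ)) : C_c(G, ℂ) where
  toFun x := conj (f (𝒢.inv x))
  continuous_toFun := Complex.continuous_conj.comp (f.continuous.comp 𝒢.continuous_inv)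
  hasCompactSupport' :=
    (f.hasCompactSupport.comp_homeomorph 𝒢.invHomeo).comp_left (g := fun z : ℂ => conj z)
      (map_zero _)

theorem ccStar_ccStar (f : C_c(G, ℂ)) : 𝒢.ccStar (𝒢.ccStar f) = f := by
  ext x
  change conj (conj (f (𝒢.inv (𝒢.inv x)))) = f x
  rw [𝒢.inv_inv, Complex.conj_conj]

/-- An `r`-section: a set `B` of arrows that meets each `r`-fiber `G^a` in a single point `e a`,
such that `a ↦ e a` is a homeomorphism from the unit space onto `B`. -/
def IsRSection (B : Set G) : Prop :=
  ∃ e : X ≃ₜ B, ∀ a : X, B ∩ {x | 𝒢.r x = a} = {(e a : G)}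

/-- An `s`-section. -/
def IsSSection (B : Set G) : Prop :=
  ∃ e : X ≃ₜ B, ∀ a : X, B ∩ {x | 𝒢.s x = a} = {(e a : G)}

/-- A bisection is both an `r`-section and an `s`-section. -/
def IsBisection (B : Set G) : Prop := 𝒢.IsRSection B ∧ 𝒢.IsSSection B

end TopGroupoid

end Groupoid

/-- A left Haar system on `𝒢`. The measure `λ^a`, carried by the fiber `G^a = r⁻¹ {a}`, is given as
a measure on `G` that vanishes off this fiber. -/
structure HaarSystem {G : Type u} {X : Type v} [TopologicalSpace G] [TopologicalSpace X]
    [MeasurableSpace G] (𝒢 : TopGroupoid G X) where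
  meas : X → Measure G
  finiteOnCompacts : ∀ a, IsFiniteMeasureOnCompacts (meas a)
  meas_compl_fiber : ∀ a, meas a {x | 𝒢.r x ≠ a} = 0
  meas_open_pos : ∀ a (V : Set G), IsOpen V → (V ∩ {x | 𝒢.r x = a}).Nonempty → 0 < meas a V
  continuous_integral : ∀ f : C_c(G, ℂ), Continuous fun a => ∫ t, f t ∂(meas a)
  left_invariant : ∀ (x : G) (f : C_c(G, ℂ)),
    ∫ y, f (𝒢.mul x y) ∂(meas (𝒢.s x)) = ∫ y, f y ∂(meas (𝒢.r x))

attribute [instance] HaarSystem.finiteOnCompacts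

/-! ### Continuous Hilbert bundles and the Fourier-Stieltjes algebra -/

/-- A continuous Hilbert bundle over `X`: a continuous field of separable Hilbert spaces in the
sense of Dixmier, `sections` being its space of continuous sections. -/
structure HilbertBundle (X : Type v) [TopologicalSpace X] where
  Fiber : X → Type u
  [normedAddCommGroup : ∀ a, NormedAddCommGroup (Fiber a)]
  [innerProductSpace : ∀ a, InnerProductSpace ℂ (Fiber a)]
  [completeSpace : ∀ a, CompleteSpace (Fiber a)]
  [secondCountable : ∀ a, SecondCountableTopology (Fiber a)]
  sections : Submodule ℂ (∀ a, Fiber a)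
  dense_sections : ∀ a, Dense {w : Fiber a | ∃ ξ ∈ sections, ξ a = w}
  continuous_norm : ∀ ξ ∈ sections, Continuous fun a => ‖ξ a‖
  mem_of_locally_approx : ∀ ξ : ∀ a, Fiber a,
    (∀ a, ∀ ε > (0 : ℝ), ∃ η ∈ sections, ∀ᶠ b in 𝓝 a, ‖ξ b - η b‖ ≤ ε) → ξ ∈ sections

attribute [instance] HilbertBundle.normedAddCommGroup HilbertBundle.innerProductSpace
  HilbertBundle.completeSpace HilbertBundle.secondCountable

namespace HilbertBundle

variable {X : Type v} [TopologicalSpace X]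

/-- The space `Δ_b` of bounded continuous sections. -/
def IsBddSection (H : HilbertBundle.{u} X) (ξ : ∀ a, H.Fiber a) : Prop :=
  ξ ∈ H.sections ∧ BddAbove (Set.range fun a => ‖ξ a‖)

/-- The norm `‖ξ‖ = sup_a ‖ξ a‖` of a bounded section. -/
def supNorm (H : HilbertBundle.{u} X) (ξ : ∀ a, H.Fiber a) : ℝ := ⨆ a, ‖ξ a‖

theorem le_supNorm (H : HilbertBundle.{u} X) {ξ : ∀ a, H.Fiber a} (h : H.IsBddSection ξ) (a : X) :
    ‖ξ a‖ ≤ H.supNorm ξ := le_ciSup h.2 a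

theorem supNorm_nonneg (H : HilbertBundle.{u} X) (ξ : ∀ a, H.Fiber a) : 0 ≤ H.supNorm ξ :=
  Real.iSup_nonneg fun _ => norm_nonneg _

theorem IsBddSection.smul {H : HilbertBundle.{u} X} {ξ : ∀ a, H.Fiber a} (h : H.IsBddSection ξ)
    (c : ℂ) : H.IsBddSection (c • ξ) := by
  refine ⟨H.sections.smul_mem c h.1, ‖c‖ * H.supNorm ξ, ?_⟩
  rintro _ ⟨a, rfl⟩
  simpa [norm_smul] using mul_le_mul_of_nonneg_left (H.le_supNorm h a) (norm_nonneg c)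

/-- The direct sum of two Hilbert bundles. -/
def directSum (H K : HilbertBundle.{u} X) : HilbertBundle.{u} X where
  Fiber a := WithLp 2 (H.Fiber a × K.Fiber a)
  sections :=
    { carrier := {ζ | (fun a => (ζ a).fst) ∈ H.sections ∧ (fun a => (ζ a).snd) ∈ K.sections}
      add_mem' := fun h h' => ⟨H.sections.add_mem h.1 h'.1, K.sections.add_mem h.2 h'.2⟩
      zero_mem' := ⟨H.sections.zero_mem, K.sections.zero_mem⟩
      smul_mem' := fun c _ h => ⟨H.sections.smul_mem c h.1, K.sections.smul_mem c h.2⟩ }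
  dense_sections a := by
    have h := ((H.dense_sections a).prod (K.dense_sections a)).preimage
      (WithLp.homeomorphProd 2 (H.Fiber a) (K.Fiber a)).isOpenMap
    refine h.mono ?_
    rintro w ⟨⟨ξ, hξ, hξw⟩, ⟨η, hη, hηw⟩⟩
    exact ⟨fun b => WithLp.toLp 2 (ξ b, η b), ⟨hξ, hη⟩, by
      change WithLp.toLp 2 (ξ a, η a) = w
      rw [hξw, hηw]; rfl⟩
  continuous_norm ζ h := by
    simp_rw [WithLp.prod_norm_eq_of_L2]
    exact (((H.continuous_norm _ h.1).pow 2).add ((K.continuous_norm _ h.2).pow 2)).sqrt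
  mem_of_locally_approx ζ h := by
    have key : ∀ a (w : WithLp 2 (H.Fiber a × K.Fiber a)), ‖w.fst‖ ≤ ‖w‖ ∧ ‖w.snd‖ ≤ ‖w‖ := by
      intro a w
      have := WithLp.prod_norm_sq_eq_of_L2 w
      constructor <;> refine abs_le_of_sq_le_sq' ?_ (norm_nonneg _) |>.2 <;>
        nlinarith [sq_nonneg ‖w.fst‖, sq_nonneg ‖w.snd‖]
    constructor
    · refine H.mem_of_locally_approx _ fun a ε hε => ?_
      obtain ⟨η, hη, hev⟩ := h a ε hε
      exact ⟨_, hη.1, hev.mono fun b hb => ((key b (ζ b - η b)).1).trans hb⟩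
    · refine K.mem_of_locally_approx _ fun a ε hε => ?_
      obtain ⟨η, hη, hev⟩ := h a ε hε
      exact ⟨_, hη.2, hev.mono fun b hb => ((key b (ζ b - η b)).2).trans hb⟩

/-- The bundle with zero fibers. -/
def zero : HilbertBundle.{u} X where
  Fiber _ := PUnit.{u + 1}
  sections := ⊤
  dense_sections a := by
    have : {w : PUnit.{u + 1} | ∃ ξ ∈ (⊤ : Submodule ℂ (X → PUnit.{u + 1})), ξ a = w} =
        Set.univ := by
      ext w; simp
    rw [this]; exact dense_univ
  continuous_norm ξ _ := by
    have : (fun a => ‖ξ a‖) = fun _ => 0 := by ext a; simp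
    rw [this]; exact continuous_const
  mem_of_locally_approx _ _ := trivial

end HilbertBundle

/-- A `G`-Hilbert bundle: a continuous Hilbert bundle over the unit space with a surjective linear
isometry `L_x` from the fiber at `s x` onto the fiber at `r x` for each arrow `x`, such that
`L_{xy} = L_x L_y` and `x ↦ ⟨L_x ξ(s x), η(r x)⟩` is continuous for all bounded continuous sections
`ξ, η`. (The units `a = r x`, `b = s x` are arguments of `act`, so that no transport between equal
fibers is needed; preservation of units and inverses follows from multiplicativity.) -/
structure GHilbertBundle {G : Type u} {X : Type v} [TopologicalSpace G] [TopologicalSpace X]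
    (𝒢 : TopGroupoid G X) extends HilbertBundle.{u} X where
  act : ∀ (x : G) {a b : X}, 𝒢.r x = a → 𝒢.s x = b → (Fiber b ≃ₗᵢ[ℂ] Fiber a)
  act_mul : ∀ (x y : G) {a b c : X} (hxr : 𝒢.r x = a) (hxs : 𝒢.s x = b) (hyr : 𝒢.r y = b)
    (hys : 𝒢.s y = c) (hr : 𝒢.r (𝒢.mul x y) = a) (hs : 𝒢.s (𝒢.mul x y) = c) (w : Fiber c),
    act (𝒢.mul x y) hr hs w = act x hxr hxs (act y hyr hys w)
  continuous_coeff : ∀ ξ η : ∀ a, Fiber a,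
    toHilbertBundle.IsBddSection ξ → toHilbertBundle.IsBddSection η →
    Continuous fun x : G => inner ℂ (act x rfl rfl (ξ (𝒢.s x))) (η (𝒢.r x))

namespace GHilbertBundle

variable {G : Type u} {X : Type v} [TopologicalSpace G] [TopologicalSpace X]
  {𝒢 : TopGroupoid G X}

/-- The coefficient `(ξ, η)(x) = ⟨L_x ξ(s x), η(r x)⟩`, inner products being conjugate linear in
the first variable. -/
def coeff (H : GHilbertBundle 𝒢) (ξ η : ∀ a, H.Fiber a) : G → ℂ :=
  fun x => inner ℂ (H.act x rfl rfl (ξ (𝒢.s x))) (η (𝒢.r x))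

/-- The direct sum of two `G`-Hilbert bundles. -/
def directSum (H K : GHilbertBundle 𝒢) : GHilbertBundle 𝒢 where
  toHilbertBundle := H.toHilbertBundle.directSum K.toHilbertBundle
  act x _ _ hr hs :=
    { toLinearEquiv := (WithLp.linearEquiv 2 ℂ _).trans
        (((H.act x hr hs).toLinearEquiv.prodCongr (K.act x hr hs).toLinearEquiv).trans
          (WithLp.linearEquiv 2 ℂ _).symm)
      norm_map' := fun (w : WithLp 2 (H.Fiber _ × K.Fiber _)) => by
        change ‖WithLp.toLp 2 (H.act x hr hs w.fst, K.act x hr hs w.snd)‖ = ‖w‖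
        rw [WithLp.prod_norm_eq_of_L2 w, WithLp.prod_norm_eq_of_L2]
        simp only [WithLp.toLp_fst, WithLp.toLp_snd, LinearIsometryEquiv.norm_map] }
  act_mul x y _ _ _ hxr hxs hyr hys hr hs (w : WithLp 2 (H.Fiber _ × K.Fiber _)) := by
    change WithLp.toLp 2 (H.act _ hr hs w.fst, K.act _ hr hs w.snd) =
      WithLp.toLp 2 (H.act x hxr hxs (H.act y hyr hys w.fst),
        K.act x hxr hxs (K.act y hyr hys w.snd))
    rw [H.act_mul x y hxr hxs hyr hys, K.act_mul x y hxr hxs hyr hys]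
  continuous_coeff ξ η hξ hη := by
    have key : ∀ a (w : WithLp 2 (H.Fiber a × K.Fiber a)), ‖w.fst‖ ≤ ‖w‖ ∧ ‖w.snd‖ ≤ ‖w‖ := by
      intro a w
      have := WithLp.prod_norm_sq_eq_of_L2 w
      constructor <;> refine abs_le_of_sq_le_sq' ?_ (norm_nonneg _) |>.2 <;>
        nlinarith [sq_nonneg ‖w.fst‖, sq_nonneg ‖w.snd‖]
    have bdd : ∀ ζ : ∀ a, WithLp 2 (H.Fiber a × K.Fiber a),
        (H.toHilbertBundle.directSum K.toHilbertBundle).IsBddSection ζ →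
        H.toHilbertBundle.IsBddSection (fun a => (ζ a).fst) ∧
        K.toHilbertBundle.IsBddSection (fun a => (ζ a).snd) := by
      rintro ζ ⟨⟨h1, h2⟩, M, hM⟩
      refine ⟨⟨h1, M, ?_⟩, ⟨h2, M, ?_⟩⟩
      · rintro _ ⟨a, rfl⟩
        exact ((key a (ζ a)).1).trans (hM ⟨a, rfl⟩)
      · rintro _ ⟨a, rfl⟩
        exact ((key a (ζ a)).2).trans (hM ⟨a, rfl⟩)
    exact (H.continuous_coeff _ _ (bdd ξ hξ).1 (bdd η hη).1).add
      (K.continuous_coeff _ _ (bdd ξ hξ).2 (bdd η hη).2)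

/-- The `G`-Hilbert bundle with zero fibers. -/
def zero (𝒢 : TopGroupoid G X) : GHilbertBundle 𝒢 where
  toHilbertBundle := HilbertBundle.zero
  act _ _ _ _ _ := LinearIsometryEquiv.refl ℂ PUnit.{u + 1}
  act_mul _ _ _ _ _ _ _ _ _ _ _ _ := rfl
  continuous_coeff _ _ _ _ := continuous_const (y := (0 : ℂ))

end GHilbertBundle

section FourierStieltjes

variable {G : Type u} {X : Type v} [TopologicalSpace G] [TopologicalSpace X]

namespace TopGroupoid

variable (𝒢 : TopGroupoid G X)

/-- The Fourier-Stieltjes algebra `B(G)`, as a set of functions on `G`. -/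
def fourierStieltjes : Set (G → ℂ) :=
  {φ | ∃ (H : GHilbertBundle 𝒢) (ξ η : ∀ a, H.Fiber a),
    H.IsBddSection ξ ∧ H.IsBddSection η ∧ H.coeff ξ η = φ}

/-- The norm of `B(G)`: the infimum of `‖ξ‖ ‖η‖` over all representations `φ = (ξ, η)`. -/
def fsNorm (φ : G → ℂ) : ℝ :=
  sInf {c | ∃ (H : GHilbertBundle 𝒢) (ξ η : ∀ a, H.Fiber a),
    H.IsBddSection ξ ∧ H.IsBddSection η ∧ H.coeff ξ η = φ ∧ c = H.supNorm ξ * H.supNorm η}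

variable {𝒢}

theorem exists_coeff_of_lt {φ : G → ℂ} (h : φ ∈ 𝒢.fourierStieltjes) {ε : ℝ}
    (hε : 𝒢.fsNorm φ < ε) : ∃ (H : GHilbertBundle 𝒢) (ξ η : ∀ a, H.Fiber a),
      H.IsBddSection ξ ∧ H.IsBddSection η ∧ H.coeff ξ η = φ ∧ H.supNorm ξ * H.supNorm η < ε := by
  obtain ⟨H, ξ, η, hξ, hη, hφ⟩ := h
  have hne : {c | ∃ (H : GHilbertBundle 𝒢) (ξ η : ∀ a, H.Fiber a), H.IsBddSection ξ ∧
      H.IsBddSection η ∧ H.coeff ξ η = φ ∧ c = H.supNorm ξ * H.supNorm η}.Nonempty :=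
    ⟨_, H, ξ, η, hξ, hη, hφ, rfl⟩
  obtain ⟨_, ⟨H', ξ', η', h1, h2, h3, rfl⟩, hlt⟩ := exists_lt_of_csInf_lt hne hε
  exact ⟨H', ξ', η', h1, h2, h3, hlt⟩

theorem fsNorm_le {H : GHilbertBundle 𝒢} {ξ η : ∀ a, H.Fiber a} (hξ : H.IsBddSection ξ)
    (hη : H.IsBddSection η) : 𝒢.fsNorm (H.coeff ξ η) ≤ H.supNorm ξ * H.supNorm η := by
  refine csInf_le ⟨0, ?_⟩ ⟨H, ξ, η, hξ, hη, rfl, rfl⟩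
  rintro _ ⟨H', ξ', η', -, -, -, rfl⟩
  exact mul_nonneg (H'.supNorm_nonneg _) (H'.supNorm_nonneg _)

theorem coeff_smul_smul (H : GHilbertBundle 𝒢) (ξ η : ∀ a, H.Fiber a) (c d : ℂ) :
    H.coeff (c • ξ) (d • η) = (conj c * d) • H.coeff ξ η := by
  ext x
  simp only [GHilbertBundle.coeff, Pi.smul_apply, map_smul, inner_smul_left, inner_smul_right,
    smul_eq_mul]
  ring

/-- A coefficient of norm `< ε` is represented by sections of norm at most `√ε`. -/
theorem exists_balanced {φ : G → ℂ} (h : φ ∈ 𝒢.fourierStieltjes) {ε : ℝ}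
    (hε : 𝒢.fsNorm φ < ε) : ∃ (H : GHilbertBundle 𝒢) (ξ η : ∀ a, H.Fiber a),
      H.IsBddSection ξ ∧ H.IsBddSection η ∧ H.coeff ξ η = φ ∧
      (∀ a, ‖ξ a‖ ^ 2 ≤ ε) ∧ ∀ a, ‖η a‖ ^ 2 ≤ ε := by
  obtain ⟨H, ξ, η, hξ, hη, hφ, hlt⟩ := exists_coeff_of_lt h hε
  set p := H.supNorm ξ with hp
  set q := H.supNorm η with hq
  have hp0 : 0 ≤ p := H.supNorm_nonneg ξ
  have hq0 : 0 ≤ q := H.supNorm_nonneg η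
  have hε0 : 0 < ε := lt_of_le_of_lt (mul_nonneg hp0 hq0) hlt
  have hs0 : 0 < Real.sqrt ε := Real.sqrt_pos.2 hε0
  have hss : Real.sqrt ε * Real.sqrt ε = ε := Real.mul_self_sqrt hε0.le
  obtain ⟨t, ht, htp, htq⟩ : ∃ t : ℝ, 0 < t ∧ t * p ≤ Real.sqrt ε ∧ t⁻¹ * q ≤ Real.sqrt ε := by
    rcases hp0.eq_or_lt with h0 | h0
    · refine ⟨(q + 1) / Real.sqrt ε, by positivity, by rw [← h0, mul_zero]; exact hs0.le, ?_⟩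
      rw [inv_div, div_mul_eq_mul_div, div_le_iff₀ (by positivity)]
      nlinarith
    · refine ⟨Real.sqrt ε / p, by positivity, by rw [div_mul_cancel₀ _ h0.ne'], ?_⟩
      rw [inv_div, div_mul_eq_mul_div, div_le_iff₀ hs0]
      nlinarith
  refine ⟨H, (t : ℂ) • ξ, ((t⁻¹ : ℝ) : ℂ) • η, hξ.smul _, hη.smul _, ?_, fun a => ?_, fun a => ?_⟩
  · rw [coeff_smul_smul, hφ]
    have : conj (t : ℂ) * ((t⁻¹ : ℝ) : ℂ) = 1 := by
      rw [Complex.conj_ofReal, ← Complex.ofReal_mul, mul_inv_cancel₀ ht.ne', Complex.ofReal_one]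
    rw [this, one_smul]
  · have h1 : ‖((t : ℂ) • ξ) a‖ ≤ Real.sqrt ε := by
      rw [Pi.smul_apply, norm_smul, Complex.norm_real, Real.norm_of_nonneg ht.le]
      exact (mul_le_mul_of_nonneg_left (H.le_supNorm hξ a) ht.le).trans htp
    nlinarith [norm_nonneg (((t : ℂ) • ξ) a)]
  · have h1 : ‖(((t⁻¹ : ℝ) : ℂ) • η) a‖ ≤ Real.sqrt ε := by
      have ht' : 0 ≤ t⁻¹ := by positivity
      rw [Pi.smul_apply, norm_smul, Complex.norm_real, Real.norm_of_nonneg ht']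
      exact (mul_le_mul_of_nonneg_left (H.le_supNorm hη a) ht').trans htq
    nlinarith [norm_nonneg ((((t⁻¹ : ℝ) : ℂ) • η) a)]

theorem fourierStieltjes_add {φ ψ : G → ℂ} (hφ : φ ∈ 𝒢.fourierStieltjes)
    (hψ : ψ ∈ 𝒢.fourierStieltjes) {δ ε : ℝ} (hδ : 𝒢.fsNorm φ < δ) (hε : 𝒢.fsNorm ψ < ε) :
    φ + ψ ∈ 𝒢.fourierStieltjes ∧ 𝒢.fsNorm (φ + ψ) ≤ δ + ε := by
  obtain ⟨H, ξ, η, hξ, hη, rfl, hξn, hηn⟩ := exists_balanced hφ hδ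
  obtain ⟨K, ξ', η', hξ', hη', rfl, hξn', hηn'⟩ := exists_balanced hψ hε
  let P := H.directSum K
  have bd : ∀ (σ : ∀ a, H.Fiber a) (τ : ∀ a, K.Fiber a), H.IsBddSection σ → K.IsBddSection τ →
      (∀ a, ‖σ a‖ ^ 2 ≤ δ) → (∀ a, ‖τ a‖ ^ 2 ≤ ε) →
      P.IsBddSection (fun a => WithLp.toLp 2 (σ a, τ a)) ∧
      P.supNorm (fun a => WithLp.toLp 2 (σ a, τ a)) ≤ Real.sqrt (δ + ε) := by
    intro σ τ hσ hτ h1 h2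
    have h3 : ∀ a, ‖(WithLp.toLp 2 (σ a, τ a) : WithLp 2 (H.Fiber a × K.Fiber a))‖ ≤
        Real.sqrt (δ + ε) := by
      intro a
      rw [WithLp.prod_norm_eq_of_L2]
      exact Real.sqrt_le_sqrt (add_le_add (h1 a) (h2 a))
    refine ⟨⟨⟨hσ.1, hτ.1⟩, Real.sqrt (δ + ε), ?_⟩, Real.iSup_le h3 (Real.sqrt_nonneg _)⟩
    rintro _ ⟨a, rfl⟩
    exact h3 a
  have b1 := bd ξ ξ' hξ hξ' hξn hξn'
  have b2 := bd η η' hη hη' hηn hηn'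
  have hco : P.coeff (fun a => WithLp.toLp 2 (ξ a, ξ' a)) (fun a => WithLp.toLp 2 (η a, η' a)) =
      H.coeff ξ η + K.coeff ξ' η' := rfl
  refine ⟨⟨P, _, _, b1.1, b2.1, hco⟩, ?_⟩
  have h0 : 0 ≤ δ + ε := by
    have h1 : 0 ≤ 𝒢.fsNorm (H.coeff ξ η) := Real.sInf_nonneg (by
      rintro _ ⟨H', ξ', η', -, -, -, rfl⟩
      exact mul_nonneg (H'.supNorm_nonneg _) (H'.supNorm_nonneg _))
    have h2 : 0 ≤ 𝒢.fsNorm (K.coeff ξ' η') := Real.sInf_nonneg (by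
      rintro _ ⟨H', ξ', η', -, -, -, rfl⟩
      exact mul_nonneg (H'.supNorm_nonneg _) (H'.supNorm_nonneg _))
    linarith
  rw [← hco]
  refine (fsNorm_le b1.1 b2.1).trans ?_
  calc _ ≤ Real.sqrt (δ + ε) * Real.sqrt (δ + ε) :=
        mul_le_mul b1.2 b2.2 (P.supNorm_nonneg _) (Real.sqrt_nonneg _)
    _ = δ + ε := Real.mul_self_sqrt h0

theorem fourierStieltjes_smul {φ : G → ℂ} (hφ : φ ∈ 𝒢.fourierStieltjes) {ε : ℝ}
    (hε : 𝒢.fsNorm φ < ε) (c : ℂ) :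
    c • φ ∈ 𝒢.fourierStieltjes ∧ 𝒢.fsNorm (c • φ) ≤ ‖c‖ * ε := by
  obtain ⟨H, ξ, η, hξ, hη, rfl, hlt⟩ := exists_coeff_of_lt hφ hε
  have hco : H.coeff ξ (c • η) = c • H.coeff ξ η := by
    have := coeff_smul_smul H ξ η 1 c
    simpa using this
  refine ⟨⟨H, ξ, c • η, hξ, hη.smul c, hco⟩, ?_⟩
  rw [← hco]
  refine (fsNorm_le hξ (hη.smul c)).trans ?_
  have h1 : H.supNorm (c • η) ≤ ‖c‖ * H.supNorm η := by
    refine Real.iSup_le (fun a => ?_) (mul_nonneg (norm_nonneg _) (H.supNorm_nonneg _))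
    rw [Pi.smul_apply, norm_smul]
    exact mul_le_mul_of_nonneg_left (H.le_supNorm hη a) (norm_nonneg c)
  calc _ ≤ H.supNorm ξ * (‖c‖ * H.supNorm η) := mul_le_mul_of_nonneg_left h1 (H.supNorm_nonneg _)
    _ = ‖c‖ * (H.supNorm ξ * H.supNorm η) := by ring
    _ ≤ ‖c‖ * ε := mul_le_mul_of_nonneg_left hlt.le (norm_nonneg c)

theorem fourierStieltjes_zero :
    (0 : G → ℂ) ∈ 𝒢.fourierStieltjes ∧ 𝒢.fsNorm 0 ≤ 0 := by
  have hb : (GHilbertBundle.zero 𝒢).IsBddSection (0 : X → PUnit.{u + 1}) := by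
    refine ⟨trivial, 0, ?_⟩
    rintro _ ⟨a, rfl⟩
    exact le_of_eq (norm_zero (E := PUnit.{u + 1}))
  have hco : (GHilbertBundle.zero 𝒢).coeff (0 : X → PUnit.{u + 1}) (0 : X → PUnit.{u + 1}) = 0 :=
    rfl
  have hn : (GHilbertBundle.zero 𝒢).supNorm (0 : X → PUnit.{u + 1}) ≤ 0 :=
    Real.iSup_le (fun a => le_of_eq (norm_zero (E := PUnit.{u + 1}))) le_rfl
  refine ⟨⟨_, _, _, hb, hb, hco⟩, ?_⟩
  have := fsNorm_le hb hb
  rw [hco] at this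
  exact this.trans (mul_nonpos_of_nonneg_of_nonpos ((GHilbertBundle.zero 𝒢).supNorm_nonneg _) hn)

end TopGroupoid

end FourierStieltjes

/-! ### The Fourier algebra -/

namespace HaarSystem

variable {G : Type u} {X : Type v} [TopologicalSpace G] [TopologicalSpace X]
  [MeasurableSpace G] {𝒢 : TopGroupoid G X} (lam : HaarSystem 𝒢)

/-- Convolution `f * g (x) = ∫ f(t) g(t⁻¹ x) dλ^{r(x)}(t)`. -/
def conv (f g : C_c(G, ℂ)) : G → ℂ :=
  fun x => ∫ t, f t * g (𝒢.mul (𝒢.inv t) x) ∂(lam.meas (𝒢.r x))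

/-- `A_cf(G)`: the set of coefficients `(f, g)`, `f, g ∈ C_c(G)`, of the left regular bundle
`{L²(G^a)}`, on which `G` acts by `(L_x h)(t) = h(x⁻¹ t)`. Explicitly
`(f, g)(x) = ∫ conj (f(x⁻¹ t)) g(t) dλ^{r(x)}(t) = (g * f*)(x)`. -/
def Acf : Set (G → ℂ) := {φ | ∃ f g : C_c(G, ℂ), φ = lam.conv g (𝒢.ccStar f)}

/-- `A_cf(V) = A_cf(G) ∩ C_c(V)` for an open set `V`. Elements of `A_cf(G)` are continuous with
compact support, so membership in `C_c(V)` only means that the support lies in `V`. -/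
def AcfOn (V : Set G) : Set (G → ℂ) := {φ | φ ∈ lam.Acf ∧ tsupport φ ⊆ V}

/-- `A_c(G)`: the algebra generated by `A_cf(G)` under pointwise operations. -/
def Ac : NonUnitalSubalgebra ℂ (G → ℂ) := NonUnitalAlgebra.adjoin ℂ lam.Acf

/-- The Fourier algebra `A(G)`: the closure of `A_c(G) ⊆ B(G)` in the normed space `B(G)`. -/
def fourierAlgebra : Submodule ℂ (G → ℂ) where
  carrier := {φ | ∀ ε > (0 : ℝ), ∃ ψ ∈ lam.Ac, φ - ψ ∈ 𝒢.fourierStieltjes ∧ 𝒢.fsNorm (φ - ψ) < ε}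
  zero_mem' := fun ε hε => ⟨0, lam.Ac.zero_mem, by
    rw [sub_zero]
    exact ⟨TopGroupoid.fourierStieltjes_zero.1, TopGroupoid.fourierStieltjes_zero.2.trans_lt hε⟩⟩
  add_mem' := by
    intro φ φ' h h' ε hε
    obtain ⟨ψ, hψ, h1, h2⟩ := h (ε / 3) (by positivity)
    obtain ⟨ψ', hψ', h1', h2'⟩ := h' (ε / 3) (by positivity)
    have h3 := TopGroupoid.fourierStieltjes_add h1 h1' h2 h2'
    refine ⟨ψ + ψ', lam.Ac.add_mem hψ hψ', ?_⟩
    rw [add_sub_add_comm]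
    exact ⟨h3.1, h3.2.trans_lt (by linarith)⟩
  smul_mem' := by
    intro c φ h ε hε
    obtain ⟨ψ, hψ, h1, h2⟩ := h (ε / (‖c‖ + 1)) (by positivity)
    have h3 := TopGroupoid.fourierStieltjes_smul h1 h2 c
    refine ⟨c • ψ, lam.Ac.smul_mem' c hψ, ?_⟩
    rw [← smul_sub]
    refine ⟨h3.1, h3.2.trans_lt ?_⟩
    rw [mul_div_assoc', div_lt_iff₀ (by positivity)]
    nlinarith [norm_nonneg c]

theorem mem_fourierAlgebra_of_mem_Ac {φ : G → ℂ} (h : φ ∈ lam.Ac) : φ ∈ lam.fourierAlgebra :=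
  fun ε hε => ⟨φ, h, by
    rw [sub_self]
    exact ⟨TopGroupoid.fourierStieltjes_zero.1, TopGroupoid.fourierStieltjes_zero.2.trans_lt hε⟩⟩

theorem conv_mem_fourierAlgebra (g f : C_c(G, ℂ)) : lam.conv g f ∈ lam.fourierAlgebra :=
  lam.mem_fourierAlgebra_of_mem_Ac (NonUnitalAlgebra.subset_adjoin ℂ
    ⟨𝒢.ccStar f, g, by rw [𝒢.ccStar_ccStar]⟩)

/-! ### Maps from `A(G)` into `D = C₀(G⁰)` -/

/-- `α` is bounded for the norm of `B(G)`. -/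
def IsBoundedMap (α : lam.fourierAlgebra →ₗ[ℂ] C₀(X, ℂ)) : Prop :=
  ∃ C : ℝ, ∀ φ : lam.fourierAlgebra, ‖α φ‖ ≤ C * 𝒢.fsNorm φ

/-- `α` is a right `D`-module map: `α(φ b) = α(φ) b`, where `(φ b)(x) = φ(x) b(r x)`. -/
def IsRightModuleMap (α : lam.fourierAlgebra →ₗ[ℂ] C₀(X, ℂ)) : Prop :=
  ∀ (φ : lam.fourierAlgebra) (b : C₀(X, ℂ))
    (h : (fun x => (φ : G → ℂ) x * b (𝒢.r x)) ∈ lam.fourierAlgebra), α ⟨_, h⟩ = α φ * b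

/-- `β` is a left `D`-module map: `β(b φ) = b β(φ)`, where `(b φ)(x) = b(s x) φ(x)`. -/
def IsLeftModuleMap (β : lam.fourierAlgebra →ₗ[ℂ] C₀(X, ℂ)) : Prop :=
  ∀ (φ : lam.fourierAlgebra) (b : C₀(X, ℂ))
    (h : (fun x => b (𝒢.s x) * (φ : G → ℂ) x) ∈ lam.fourierAlgebra), β ⟨_, h⟩ = b * β φ

/-- `α` is multiplicative for the pointwise product of `A(G)`. -/
def IsMultiplicative (α : lam.fourierAlgebra →ₗ[ℂ] C₀(X, ℂ)) : Prop :=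
  ∀ (φ ψ : lam.fourierAlgebra) (h : (φ : G → ℂ) * (ψ : G → ℂ) ∈ lam.fourierAlgebra),
    α ⟨_, h⟩ = α φ * α ψ

section E2

variable [OpensMeasurableSpace G]

/-- The section `a ↦ f|_{G^a}` of the bundle `{L²(G^a)}` determined by `f ∈ C_c(G)`. -/
def ccSection (f : C_c(G, ℂ)) (a : X) : Lp ℂ 2 (lam.meas a) :=
  (f.continuous.memLp_of_hasCompactSupport f.hasCompactSupport).toLp f

/-- The Hilbert `D`-module `E²`: the continuous sections of `{L²(G^a)}` (those that are locally
uniformly approximable by the sections determined by `C_c(G)`) which vanish at infinity. -/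
def E2 : Set (∀ a, Lp ℂ 2 (lam.meas a)) :=
  {F | (∀ a, ∀ ε > (0 : ℝ), ∃ f : C_c(G, ℂ), ∀ᶠ b in 𝓝 a, ‖F b - lam.ccSection f b‖ ≤ ε) ∧
    ∀ ε > (0 : ℝ), ∃ K : Set X, IsCompact K ∧ ∀ a, a ∉ K → ‖F a‖ ≤ ε}

/-- The norm `‖F‖ = sup_a ‖F a‖` of `E²`. -/
def e2Norm (F : ∀ a, Lp ℂ 2 (lam.meas a)) : ℝ := ⨆ a, ‖F a‖

theorem ccSection_mem_E2 (f : C_c(G, ℂ)) : lam.ccSection f ∈ lam.E2 := by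
  refine ⟨fun a ε hε => ⟨f, Filter.Eventually.of_forall fun b => by simpa using hε.le⟩,
    fun ε hε => ⟨𝒢.r '' tsupport f, f.hasCompactSupport.isCompact.image 𝒢.continuous_r,
      fun a ha => ?_⟩⟩
  have h0 : (f : G → ℂ) =ᵐ[lam.meas a] 0 := by
    refine measure_mono_null (fun x hx => ?_) (lam.meas_compl_fiber a)
    intro hr
    apply ha
    refine ⟨x, subset_tsupport _ ?_, hr⟩
    exact hx
  rw [ccSection, Lp.norm_toLp, eLpNorm_congr_ae h0, eLpNorm_zero, ENNReal.toReal_zero]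
  exact hε.le

/-- `T : E² → D` is a compact map of Hilbert `D`-modules: it is a norm limit of finite sums of the
rank one maps `F ↦ b ⟨ξ, F⟩` with `b ∈ D`, `ξ ∈ E²`. -/
def IsCompactModuleMap (T : lam.E2 → C₀(X, ℂ)) : Prop :=
  ∀ ε > (0 : ℝ), ∃ (n : ℕ) (b : Fin n → C₀(X, ℂ)) (ξ : Fin n → lam.E2),
    ∀ (F : lam.E2) (a : X),
      ‖T F a - ∑ i, b i a * inner ℂ ((ξ i).1 a) (F.1 a)‖ ≤ ε * lam.e2Norm F.1

/-- The sums `∑ ‖f_n‖ ‖g_n‖` over all expressions `φ = ∑ g_n * f_n*` with `f_n, g_n ∈ C_c(G)`. -/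
def calASums (φ : G → ℂ) : Set ℝ :=
  {c | ∃ f g : ℕ → C_c(G, ℂ),
    HasSum (fun n => lam.e2Norm (lam.ccSection (f n)) * lam.e2Norm (lam.ccSection (g n))) c ∧
    ∀ x, HasSum (fun n => lam.conv (g n) (𝒢.ccStar (f n)) x) (φ x)}

/-- The space `𝒜(G)`, the image of the projective tensor product of `E²` with itself under
`f ⊗ g ↦ g * f*`, realized as a space of functions on `G`; it is contained in `A(G)`. -/
def calA : Set (G → ℂ) := {φ | (lam.calASums φ).Nonempty}

/-- The norm `‖φ‖₁ = inf ∑ ‖f_n‖ ‖g_n‖` of `𝒜(G)`. -/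
def calANorm (φ : G → ℂ) : ℝ := sInf (lam.calASums φ)

/-- The restriction of `α` to `𝒜(G) ⊆ A(G)` belongs to `𝒜_K^r(G)'`: it is bounded for `‖·‖₁`, a
right `D`-module map, and for each `f ∈ C_c(G)` the map `fα : g ↦ α(g * f)` extends from `C_c(G)`
to a compact map `E² → D`. -/
def RestrictsToCompactDual (α : lam.fourierAlgebra →ₗ[ℂ] C₀(X, ℂ)) : Prop :=
  (∃ C : ℝ, ∀ φ : lam.fourierAlgebra, (φ : G → ℂ) ∈ lam.calA → ‖α φ‖ ≤ C * lam.calANorm φ) ∧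
  (∀ (φ : lam.fourierAlgebra) (b : C₀(X, ℂ))
    (h : (fun x => (φ : G → ℂ) x * b (𝒢.r x)) ∈ lam.fourierAlgebra),
    (φ : G → ℂ) ∈ lam.calA → α ⟨_, h⟩ = α φ * b) ∧
  ∀ f : C_c(G, ℂ), ∃ T : lam.E2 → C₀(X, ℂ), lam.IsCompactModuleMap T ∧
    ∀ g : C_c(G, ℂ),
      T ⟨lam.ccSection g, lam.ccSection_mem_E2 g⟩ = α ⟨_, lam.conv_mem_fourierAlgebra g f⟩

/-- A multiplicative module map on `A(G)` is a pair `(α, β)` of bounded linear maps `A(G) → D` with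
the following properties. -/
structure IsMultiplicativeModuleMap (α β : lam.fourierAlgebra →ₗ[ℂ] C₀(X, ℂ)) : Prop where
  bounded_left : lam.IsBoundedMap α
  bounded_right : lam.IsBoundedMap β
  rightModule : lam.IsRightModuleMap α
  leftModule : lam.IsLeftModuleMap β
  nonzero : ∀ a : X, ∃ φ : lam.fourierAlgebra, α φ a ≠ 0
  exists_homeo : ∃ J : X ≃ₜ X, ∀ (φ : lam.fourierAlgebra) (a : X), β φ (J a) = α φ a
  compactDual : lam.RestrictsToCompactDual α
  multiplicative : lam.IsMultiplicative α

end E2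

/-! ### The sections determined by `α` and `β` -/

/-- The set of `x ∈ G` such that for each open neighborhood `V` of `x` some `φ ∈ A_cf(V)` satisfies
`α(φ)(r x) ≠ 0`. -/
def rCarrier (α : lam.fourierAlgebra →ₗ[ℂ] C₀(X, ℂ)) : Set G :=
  {x | ∀ V : Set G, IsOpen V → x ∈ V →
    ∃ φ : lam.fourierAlgebra, (φ : G → ℂ) ∈ lam.AcfOn V ∧ α φ (𝒢.r x) ≠ 0}

/-- The same set for the reversed groupoid, in which `r` and `s` are interchanged. (Since `A_cf(G)`
is invariant under `φ ↦ φ(·⁻¹)`, both groupoids have the same `A_cf`.) -/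
def sCarrier (β : lam.fourierAlgebra →ₗ[ℂ] C₀(X, ℂ)) : Set G :=
  {x | ∀ V : Set G, IsOpen V → x ∈ V →
    ∃ φ : lam.fourierAlgebra, (φ : G → ℂ) ∈ lam.AcfOn V ∧ β φ (𝒢.s x) ≠ 0}

/-- `γ` is the global `r`-section determined by `α`: for each unit `a`, `γ a` is the one point of
`rCarrier α` in the fiber `G^a`. -/
def IsRSectionOf (α : lam.fourierAlgebra →ₗ[ℂ] C₀(X, ℂ)) (γ : X → G) : Prop :=
  ∀ a : X, lam.rCarrier α ∩ {x | 𝒢.r x = a} = {γ a}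

/-- `δ` is the global `s`-section determined by `β`. -/
def IsSSectionOf (β : lam.fourierAlgebra →ₗ[ℂ] C₀(X, ℂ)) (δ : X → G) : Prop :=
  ∀ a : X, lam.sCarrier β ∩ {x | 𝒢.s x = a} = {δ a}

end HaarSystem

end

/-! For a fixed unit `a` the functional `φ ↦ α φ a` is a bounded nonzero character of the Fourier
algebra, and `γ a` is the point of `G^a` at which it is concentrated.

Existence rests on localization. Suppose that every point of `G^a` has a neighborhood `V` such that
the character kills `A_cf(V)`. The support of a convolution `g * f` lies in the product of the two
supports, so `α (g * f) a = 0` once `g` and `f` are supported near given points. Partitions of unity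
in each variable extend this to all `g, f ∈ C_c(G)` (`IsRightModuleMap.conv_eq_zero`).
Multiplicativity and density then make the character zero, a contradiction.

Everything else comes from `IsMultiplicative.mem_tsupport_of_ne_zero`: if `α φ a ≠ 0`, then every
carrier point over `a` lies in the support of `φ`, since otherwise some `ψ` that the character does
not kill would satisfy `φ ψ = 0`. This yields uniqueness. It also yields continuity of `γ`, because
`α φ` is continuous and so stays nonzero near `a`. Finally `β φ (J a) = α φ a` makes `γ a` the
carrier point of `β` at `J a`; the left module property forces `s (γ a) = J a`, so that `δ = γ ∘
J⁻¹` has the same range as `γ`. -/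

/-! ### Localization of functionals on `C_c(G)` by partitions of unity. -/

section SupportPrinciple

variable {G : Type*} [TopologicalSpace G] [T2Space G] [LocallyCompactSpace G]

/-- An additive functional on `C_c(G)` which vanishes locally near the support of `g` vanishes
at `g`. -/
theorem CompactlySupportedContinuousMap.map_eq_zero_of_locally (Λ : C_c(G, ℂ) →+ ℂ)
    (g : C_c(G, ℂ))
    (h : ∀ t ∈ tsupport g, ∃ U : Set G, IsOpen U ∧ t ∈ U ∧
      ∀ g' : C_c(G, ℂ), tsupport g' ⊆ U → Λ g' = 0) : Λ g = 0 := by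
  choose! U hU htU hΛ using h
  obtain ⟨F, hF⟩ := g.hasCompactSupport.isCompact.elim_finite_subcover
    (fun t : tsupport g => U t) (fun t => hU t t.2)
    (fun t ht => Set.mem_iUnion.2 ⟨⟨t, ht⟩, htU t ht⟩)
  have hcov : tsupport g ⊆ ⋃ i, (fun i => U (F.equivFin.symm i : tsupport g)) i := by
    intro x hx
    obtain ⟨t, htF, hxt⟩ := Set.mem_iUnion₂.1 (hF hx)
    exact Set.mem_iUnion.2 ⟨F.equivFin ⟨t, htF⟩, by simpa using hxt⟩
  obtain ⟨p, hpU, hp1, -, hpc⟩ := exists_continuous_sum_one_of_isOpen_isCompact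
    (s := fun i => U (F.equivFin.symm i : tsupport g)) (fun i => hU _ (Subtype.coe_prop _))
    g.hasCompactSupport.isCompact hcov
  let q : Fin F.card → C_c(G, ℂ) := fun i =>
    { toFun := fun x => (p i x : ℂ) * g x
      continuous_toFun := (Complex.continuous_ofReal.comp (p i).continuous).mul g.continuous
      hasCompactSupport' := g.hasCompactSupport.mul_left }
  have hsum : g = ∑ i, q i := by
    ext x
    rw [CompactlySupportedContinuousMap.sum_apply]
    change g x = ∑ i, (p i x : ℂ) * g x
    rw [← Finset.sum_mul]
    -- The `p i` sum to 1 only on the support of `g`; elsewhere both sides vanish.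
    by_cases hx : x ∈ tsupport g
    · have h1 := hp1 hx
      simp only [Pi.one_apply, Finset.sum_apply] at h1
      rw [← Complex.ofReal_sum, h1, Complex.ofReal_one, one_mul]
    · rw [image_eq_zero_of_notMem_tsupport hx, mul_zero]
  rw [hsum, map_sum]
  refine Finset.sum_eq_zero fun i _ => hΛ _ (F.equivFin.symm i : tsupport g).2 _ ?_
  refine (closure_mono fun x hx => ?_).trans (hpU i)
  have : (p i x : ℂ) ≠ 0 := left_ne_zero_of_mul hx
  exact_mod_cast this

end SupportPrinciple

/-! ### Topological and algebraic preliminaries. -/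

/-- A continuous map `γ` with a continuous left inverse `p` is a homeomorphism onto its range,
with inverse `p`. -/
theorem exists_homeomorph_range {G X : Type*} [TopologicalSpace G] [TopologicalSpace X]
    {p : G → X} {γ : X → G} (hp : Continuous p) (hγ : Continuous γ) (h : ∀ a, p (γ a) = a)
    {B : Set G} (hB : Set.range γ = B) :
    ∃ e : B ≃ₜ X, (∀ x : B, e x = p x) ∧ ∀ a : X, γ a = e.symm a := by
  subst hB
  exact ⟨{ toFun := fun x => p x
           invFun := fun a => ⟨γ a, a, rfl⟩
           left_inv := by rintro ⟨_, a, rfl⟩; simp [h]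
           right_inv := h
           continuous_toFun := hp.comp continuous_subtype_val
           continuous_invFun := hγ.subtype_mk _ }, fun _ => rfl, fun _ => rfl⟩

theorem inter_fiber_eq_singleton {G X : Type*} {p : G → X} {γ : X → G} (h : ∀ a, p (γ a) = a)
    (a : X) : Set.range γ ∩ {x | p x = a} = {γ a} := by
  ext x
  constructor
  · rintro ⟨⟨b, rfl⟩, hb : p (γ b) = a⟩
    rw [h] at hb
    rw [hb]; rfl
  · rintro rfl
    exact ⟨⟨a, rfl⟩, h a⟩

/-- On a locally compact Hausdorff space, functions in `C₀` separate points from neighborhoods. -/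
theorem exists_zeroAtInfty_one_zero {X : Type*} [TopologicalSpace X] [T2Space X]
    [LocallyCompactSpace X] {a c : X} (hac : c ≠ a) :
    ∃ (b : C₀(X, ℂ)) (M : Set X), IsOpen M ∧ c ∈ M ∧ b a = 1 ∧ ∀ d ∈ M, b d = 0 := by
  obtain ⟨N, M, hN, hM, haN, hcM, hd⟩ := t2_separation hac.symm
  obtain ⟨k, hk1, hk0, hkc, -⟩ := exists_continuous_one_zero_of_isCompact
    (isCompact_singleton (x := a)) hN.isClosed_compl
    (Set.disjoint_compl_right_iff_subset.2 (Set.singleton_subset_iff.2 haN))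
  refine ⟨{ toFun := fun x => (k x : ℂ)
            continuous_toFun := Complex.continuous_ofReal.comp k.continuous
            zero_at_infty' := ?_ }, M, hM, hcM, ?_, fun d hdM => ?_⟩
  · have : HasCompactSupport fun x => (k x : ℂ) :=
      hkc.comp_left (g := fun t : ℝ => (t : ℂ)) (by simp)
    exact this.is_zero_at_infty
  · have : k a = 1 := hk1 rfl
    change (k a : ℂ) = 1
    rw [this, Complex.ofReal_one]
  · have : k d = 0 := hk0 (hd.subset_compl_left hdM)
    change (k d : ℂ) = 0
    rw [this, Complex.ofReal_zero]

theorem TopGroupoid.mul_inv_mul_cancel {G X : Type*} [TopologicalSpace G] [TopologicalSpace X]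
    (𝒢 : TopGroupoid G X) {t x : G} (h : 𝒢.r t = 𝒢.r x) :
    𝒢.mul t (𝒢.mul (𝒢.inv t) x) = x := by
  rw [← 𝒢.mul_assoc _ _ _ (𝒢.r_inv t).symm (by rw [𝒢.s_inv, h]), 𝒢.mul_inv, h, 𝒢.unit_mul]

namespace HaarSystem

variable {G : Type u} {X : Type v} [TopologicalSpace G] [TopologicalSpace X]
  [MeasurableSpace G] {𝒢 : TopGroupoid G X} (lam : HaarSystem 𝒢)

/-! ### Supports, integrability and additivity of convolutions. -/

section Convolution

theorem ae_mem_fiber (a : X) : ∀ᵐ t ∂(lam.meas a), 𝒢.r t = a := lam.meas_compl_fiber a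

/-- The integrand must be nonzero at some `t` of the fiber that carries the measure; then `y = t⁻¹
x` is the second factor. Composability of `t` and `y` is recorded because `mul` is meaningless
without it. -/
theorem exists_of_conv_ne_zero {g f : C_c(G, ℂ)} {x : G} (h : lam.conv g f x ≠ 0) :
    ∃ t y, t ∈ tsupport g ∧ y ∈ tsupport f ∧ 𝒢.s t = 𝒢.r y ∧ 𝒢.mul t y = x := by
  by_contra! hne
  refine h (integral_eq_zero_of_ae ?_)
  filter_upwards [lam.ae_mem_fiber (𝒢.r x)] with t ht
  by_contra hmul
  refine hne t (𝒢.mul (𝒢.inv t) x) (subset_tsupport _ (left_ne_zero_of_mul hmul))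
    (subset_tsupport _ (right_ne_zero_of_mul hmul)) ?_ (𝒢.mul_inv_mul_cancel ht)
  rw [𝒢.r_mul _ _ (by rw [𝒢.s_inv, ht]), 𝒢.r_inv]

/-- The composable pairs form a closed set because `X` is Hausdorff, so the right-hand side is a
continuous image of a compact set. It is therefore closed and contains the closure of the
nonvanishing set. -/
theorem tsupport_conv_subset [T2Space G] [T2Space X] (g f : C_c(G, ℂ)) :
    tsupport (lam.conv g f) ⊆
      (fun p : G × G => 𝒢.mul p.1 p.2) '' (tsupport g ×ˢ tsupport f ∩ {p | 𝒢.s p.1 = 𝒢.r p.2}) := by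
  have hK : IsCompact (tsupport g ×ˢ tsupport f ∩ {p : G × G | 𝒢.s p.1 = 𝒢.r p.2}) :=
    (g.hasCompactSupport.isCompact.prod f.hasCompactSupport.isCompact).inter_right
      (isClosed_eq (𝒢.continuous_s.comp continuous_fst) (𝒢.continuous_r.comp continuous_snd))
  refine closure_minimal (fun x hx => ?_)
    (hK.image_of_continuousOn (𝒢.continuous_mul.mono Set.inter_subset_right)).isClosed
  obtain ⟨t, y, ht, hy, hty, rfl⟩ := lam.exists_of_conv_ne_zero hx
  exact ⟨(t, y), ⟨⟨ht, hy⟩, hty⟩, rfl⟩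

theorem conv_mem_Acf (g f : C_c(G, ℂ)) : lam.conv g f ∈ lam.Acf :=
  ⟨𝒢.ccStar f, g, by rw [𝒢.ccStar_ccStar]⟩

variable [T2Space G] [T2Space X] [BorelSpace G]

/-- Off the fiber `mul` takes arbitrary values, so the integrand is controlled only on the compact
set `K`, where it is continuous. Almost everywhere it equals its restriction to `K` extended by
zero. -/
theorem integrable_conv (g f : C_c(G, ℂ)) (x : G) :
    Integrable (fun t => g t * f (𝒢.mul (𝒢.inv t) x)) (lam.meas (𝒢.r x)) := by
  set K := tsupport g ∩ {t | 𝒢.r t = 𝒢.r x} with hKdef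
  have hF : IsClosed {t | 𝒢.r t = 𝒢.r x} := isClosed_eq 𝒢.continuous_r continuous_const
  have hK : IsCompact K := g.hasCompactSupport.isCompact.inter_right hF
  have hc : ContinuousOn (fun t => g t * f (𝒢.mul (𝒢.inv t) x)) K := by
    refine g.continuous.continuousOn.mul (f.continuous.comp_continuousOn ?_)
    refine 𝒢.continuous_mul.comp (f := fun t => (𝒢.inv t, x))
      (𝒢.continuous_inv.prodMk continuous_const).continuousOn fun t ht => ?_
    change 𝒢.s (𝒢.inv t) = 𝒢.r x
    rw [𝒢.s_inv]
    exact ht.2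
  have hi := hc.integrableOn_compact (μ := lam.meas (𝒢.r x)) hK
  refine ((integrable_indicator_iff hK.measurableSet).2 hi).congr ?_
  filter_upwards [lam.ae_mem_fiber (𝒢.r x)] with t ht
  by_cases htg : t ∈ tsupport g
  · rw [Set.indicator_of_mem (show t ∈ K from ⟨htg, ht⟩)]
  · rw [Set.indicator_of_notMem (fun h : t ∈ K => htg h.1),
      image_eq_zero_of_notMem_tsupport htg, zero_mul]

theorem conv_add_left (g g' f : C_c(G, ℂ)) :
    lam.conv (g + g') f = lam.conv g f + lam.conv g' f := by
  ext x
  simp only [conv, Pi.add_apply, CompactlySupportedContinuousMap.add_apply, add_mul]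
  exact integral_add (lam.integrable_conv g f x) (lam.integrable_conv g' f x)

theorem conv_add_right (g f f' : C_c(G, ℂ)) :
    lam.conv g (f + f') = lam.conv g f + lam.conv g f' := by
  ext x
  simp only [conv, Pi.add_apply, CompactlySupportedContinuousMap.add_apply, mul_add]
  exact integral_add (lam.integrable_conv g f x) (lam.integrable_conv g f' x)

end Convolution

/-! ### Carrier points of multiplicative maps: uniqueness and position. -/

section Functionals

variable {lam} {α β : lam.fourierAlgebra →ₗ[ℂ] C₀(X, ℂ)}

theorem IsMultiplicative.mul_eq_zero (hα : lam.IsMultiplicative α) {φ ψ : lam.fourierAlgebra}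
    (h : (φ : G → ℂ) * (ψ : G → ℂ) = 0) (a : X) : α φ a * α ψ a = 0 := by
  have h0 : (φ : G → ℂ) * (ψ : G → ℂ) ∈ lam.fourierAlgebra := h ▸ lam.fourierAlgebra.zero_mem
  have h1 := hα φ ψ h0
  have h2 : (⟨_, h0⟩ : lam.fourierAlgebra) = 0 := Subtype.ext h
  rw [h2, map_zero] at h1
  exact (DFunLike.congr_fun h1 a).symm

/-- If `α` is multiplicative and `x ∈ rCarrier α`, then `α φ (r x) ≠ 0` forces `x ∈ supp φ`. -/
theorem IsMultiplicative.mem_tsupport_of_ne_zero (hα : lam.IsMultiplicative α) {x : G} {a : X}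
    (hx : ∀ V : Set G, IsOpen V → x ∈ V →
      ∃ φ : lam.fourierAlgebra, (φ : G → ℂ) ∈ lam.AcfOn V ∧ α φ a ≠ 0)
    {φ : lam.fourierAlgebra} (hφ : α φ a ≠ 0) : x ∈ tsupport (φ : G → ℂ) := by
  by_contra hxφ
  obtain ⟨ψ, hψ, hψa⟩ := hx _ (isClosed_tsupport (φ : G → ℂ)).isOpen_compl hxφ
  -- `ψ` is supported in the complement of the support of `φ`, so `φ ψ = 0`, although the character
  -- is nonzero on both factors.
  refine mul_ne_zero hφ hψa (hα.mul_eq_zero (funext fun y => ?_) a)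
  by_cases hy : y ∈ tsupport (φ : G → ℂ)
  · have : y ∉ tsupport (ψ : G → ℂ) := fun h => hψ.2 h hy
    simp [image_eq_zero_of_notMem_tsupport this]
  · simp [image_eq_zero_of_notMem_tsupport hy]

/-- A multiplicative map has at most one carrier point over a given unit. -/
theorem IsMultiplicative.carrier_subsingleton [T2Space G] (hα : lam.IsMultiplicative α)
    {x y : G} {a : X}
    (hx : ∀ V : Set G, IsOpen V → x ∈ V →
      ∃ φ : lam.fourierAlgebra, (φ : G → ℂ) ∈ lam.AcfOn V ∧ α φ a ≠ 0)
    (hy : ∀ V : Set G, IsOpen V → y ∈ V →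
      ∃ φ : lam.fourierAlgebra, (φ : G → ℂ) ∈ lam.AcfOn V ∧ α φ a ≠ 0) : x = y := by
  by_contra hne
  obtain ⟨V, W, hV, -, hxV, hyW, hd⟩ := t2_separation hne
  obtain ⟨φ, hφ, hφa⟩ := hx V hV hxV
  -- Since `α φ a ≠ 0`, the other carrier point `y` lies in the support of `φ`, hence in `V`, which
  -- is disjoint from `W`.
  exact Set.disjoint_left.1 hd (hφ.2 (hα.mem_tsupport_of_ne_zero hy hφa)) hyW

/-- This makes the uniqueness of carrier points available for `β`. -/
theorem IsMultiplicative.of_homeo (hα : lam.IsMultiplicative α) {J : X ≃ₜ X}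
    (hJ : ∀ (φ : lam.fourierAlgebra) (a : X), β φ (J a) = α φ a) : lam.IsMultiplicative β := by
  intro φ ψ h
  ext c
  obtain ⟨a, rfl⟩ := J.surjective c
  rw [ZeroAtInftyContinuousMap.mul_apply, hJ, hJ, hJ, hα φ ψ h,
    ZeroAtInftyContinuousMap.mul_apply]

/-- A right module map vanishes at `a` on functions that vanish near the fiber `G^a`. -/
theorem IsRightModuleMap.apply_eq_zero (hα : lam.IsRightModuleMap α) {φ : lam.fourierAlgebra}
    {b : C₀(X, ℂ)} {a : X} (hb : b a = 1) (h : ∀ x, (φ : G → ℂ) x * b (𝒢.r x) = 0) :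
    α φ a = 0 := by
  have h0 : (fun x => (φ : G → ℂ) x * b (𝒢.r x)) = 0 := funext h
  have h1 := hα φ b (h0 ▸ lam.fourierAlgebra.zero_mem)
  have h2 : (⟨_, h0 ▸ lam.fourierAlgebra.zero_mem⟩ : lam.fourierAlgebra) = 0 := Subtype.ext h0
  rw [h2, map_zero] at h1
  have h3 := DFunLike.congr_fun h1 a
  rw [ZeroAtInftyContinuousMap.mul_apply, hb, mul_one] at h3
  exact h3.symm

/-- A left module map vanishes at `a` on functions that vanish near the fiber `G_a`. -/
theorem IsLeftModuleMap.apply_eq_zero (hβ : lam.IsLeftModuleMap β) {φ : lam.fourierAlgebra}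
    {b : C₀(X, ℂ)} {a : X} (hb : b a = 1) (h : ∀ x, b (𝒢.s x) * (φ : G → ℂ) x = 0) :
    β φ a = 0 := by
  have h0 : (fun x => b (𝒢.s x) * (φ : G → ℂ) x) = 0 := funext h
  have h1 := hβ φ b (h0 ▸ lam.fourierAlgebra.zero_mem)
  have h2 : (⟨_, h0 ▸ lam.fourierAlgebra.zero_mem⟩ : lam.fourierAlgebra) = 0 := Subtype.ext h0
  rw [h2, map_zero] at h1
  have h3 := DFunLike.congr_fun h1 a
  rw [ZeroAtInftyContinuousMap.mul_apply, hb, one_mul] at h3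
  exact h3.symm

/-- A point near which a left module map does not vanish at `a` lies in `G_a`. -/
theorem IsLeftModuleMap.s_eq [T2Space X] [LocallyCompactSpace X] (hβ : lam.IsLeftModuleMap β)
    {x : G} {a : X}
    (hx : ∀ V : Set G, IsOpen V → x ∈ V →
      ∃ φ : lam.fourierAlgebra, (φ : G → ℂ) ∈ lam.AcfOn V ∧ β φ a ≠ 0) : 𝒢.s x = a := by
  by_contra hne
  obtain ⟨b, M, hM, hxM, hba, hbM⟩ := exists_zeroAtInfty_one_zero hne
  obtain ⟨φ, hφ, hφa⟩ := hx _ (hM.preimage 𝒢.continuous_s) hxM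
  refine hφa (hβ.apply_eq_zero hba fun y => ?_)
  by_cases hy : y ∈ tsupport (φ : G → ℂ)
  · rw [hbM _ (hφ.2 hy), zero_mul]
  · rw [image_eq_zero_of_notMem_tsupport hy, mul_zero]

/-- A bounded multiplicative map that vanishes at `a` on all convolutions vanishes at `a`. -/
theorem IsMultiplicative.apply_eq_zero_of_conv (hα : lam.IsMultiplicative α)
    (hb : lam.IsBoundedMap α) {a : X}
    (h : ∀ g f : C_c(G, ℂ), α ⟨_, lam.conv_mem_fourierAlgebra g f⟩ a = 0)
    (φ : lam.fourierAlgebra) : α φ a = 0 := by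
  have hAc : ∀ (ψ : G → ℂ) (hψ : ψ ∈ lam.Ac),
      α ⟨ψ, lam.mem_fourierAlgebra_of_mem_Ac hψ⟩ a = 0 := by
    intro ψ hψ
    induction hψ using NonUnitalAlgebra.adjoin_induction with
    | mem ψ hψ =>
      obtain ⟨f, g, rfl⟩ := hψ
      exact h g _
    | add ψ ψ' hψ hψ' h1 h2 =>
      have := congrArg (fun k : C₀(X, ℂ) => k a)
        (map_add α ⟨ψ, lam.mem_fourierAlgebra_of_mem_Ac hψ⟩
          ⟨ψ', lam.mem_fourierAlgebra_of_mem_Ac hψ'⟩)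
      refine this.trans ?_
      rw [ZeroAtInftyContinuousMap.add_apply, h1, h2, add_zero]
    | zero => exact congrArg (fun k : C₀(X, ℂ) => k a) (map_zero α)
    | mul ψ ψ' hψ hψ' h1 h2 =>
      have := congrArg (fun k : C₀(X, ℂ) => k a)
        (hα ⟨ψ, lam.mem_fourierAlgebra_of_mem_Ac hψ⟩ ⟨ψ', lam.mem_fourierAlgebra_of_mem_Ac hψ'⟩
          (lam.mem_fourierAlgebra_of_mem_Ac (lam.Ac.mul_mem hψ hψ')))
      refine this.trans ?_
      rw [ZeroAtInftyContinuousMap.mul_apply, h1, zero_mul]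
    | smul c ψ hψ h1 =>
      have := congrArg (fun k : C₀(X, ℂ) => k a)
        (map_smul α c ⟨ψ, lam.mem_fourierAlgebra_of_mem_Ac hψ⟩)
      refine this.trans ?_
      rw [ZeroAtInftyContinuousMap.smul_apply, h1, smul_zero]
  obtain ⟨C, hC⟩ := hb
  refine norm_le_zero_iff.1 (le_of_forall_pos_le_add fun ε hε => ?_)
  -- The bound `C` may be zero or negative; `|C| + 1` is a positive bound that can be divided by.
  obtain ⟨ψ, hψ, -, hlt⟩ := φ.2 (ε / (|C| + 1)) (by positivity)
  set ψ' : lam.fourierAlgebra := ⟨ψ, lam.mem_fourierAlgebra_of_mem_Ac hψ⟩ with hψ'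
  have h1 : α φ a = α (φ - ψ') a := by
    rw [map_sub, ZeroAtInftyContinuousMap.sub_apply, hψ', hAc ψ hψ, sub_zero]
  have h0 : 0 ≤ 𝒢.fsNorm ((φ : G → ℂ) - ψ) := Real.sInf_nonneg (by
    rintro _ ⟨H', ξ', η', -, -, -, rfl⟩
    exact mul_nonneg (H'.supNorm_nonneg _) (H'.supNorm_nonneg _))
  have h2 : ‖α (φ - ψ') a‖ ≤ ‖α (φ - ψ')‖ :=
    (α (φ - ψ')).toBCF.norm_coe_le_norm a
  have h3 : ‖α (φ - ψ')‖ ≤ C * 𝒢.fsNorm ((φ : G → ℂ) - ψ) := hC (φ - ψ')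
  have h4 : C * 𝒢.fsNorm ((φ : G → ℂ) - ψ) ≤ (|C| + 1) * (ε / (|C| + 1)) :=
    mul_le_mul ((le_abs_self C).trans (by linarith)) hlt.le h0 (by positivity)
  rw [mul_div_cancel₀ _ (by positivity)] at h4
  rw [h1, zero_add]
  exact h2.trans (h3.trans h4)

/-! ### Existence of carrier points. -/

variable [T2Space G] [T2Space X] [LocallyCompactSpace X]

/-- A right module map without carrier points in `G^a` vanishes at `a` on convolutions of functions
supported near two given points. -/
theorem IsRightModuleMap.exists_nhds_conv_eq_zero (hα : lam.IsRightModuleMap α) {a : X}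
    (h : ∀ x, 𝒢.r x = a → x ∉ lam.rCarrier α) (t y : G) :
    ∃ U W : Set G, IsOpen U ∧ IsOpen W ∧ t ∈ U ∧ y ∈ W ∧ ∀ g f : C_c(G, ℂ),
      tsupport g ⊆ U → tsupport f ⊆ W → α ⟨_, lam.conv_mem_fourierAlgebra g f⟩ a = 0 := by
  by_cases hty : 𝒢.s t = 𝒢.r y
  · by_cases hta : 𝒢.r t = a
    · have hr : 𝒢.r (𝒢.mul t y) = a := by rw [𝒢.r_mul _ _ hty, hta]
      have hx := h _ hr
      simp only [rCarrier, Set.mem_ofPred_eq, hr] at hx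
      push Not at hx
      obtain ⟨V, hV, hxV, hα0⟩ := hx
      -- Continuity of `mul` holds only within the composable pairs. That suffices, since
      -- `tsupport_conv_subset` involves no other products.
      have hnhds := 𝒢.continuous_mul (t, y) hty (hV.mem_nhds hxV)
      obtain ⟨N, hN, hsub⟩ := mem_nhdsWithin_iff_exists_mem_nhds_inter.1 hnhds
      obtain ⟨U, W, hU, htU, hW, hyW, hUW⟩ := mem_nhds_prod_iff'.1 hN
      refine ⟨U, W, hU, hW, htU, hyW, fun g f hg hf => hα0 _ ⟨lam.conv_mem_Acf g f, ?_⟩⟩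
      refine (lam.tsupport_conv_subset g f).trans ?_
      rintro _ ⟨p, ⟨hp, hps⟩, rfl⟩
      exact hsub ⟨hUW ⟨hg hp.1, hf hp.2⟩, hps⟩
    -- If `r t ≠ a`, then for `g` supported near `t` the convolution lives over a set of units where
    -- `b` vanishes, while `b a = 1`.
    · obtain ⟨b, M, hM, htM, hba, hbM⟩ := exists_zeroAtInfty_one_zero hta
      refine ⟨𝒢.r ⁻¹' M, Set.univ, hM.preimage 𝒢.continuous_r, isOpen_univ, htM, trivial,
        fun g f hg _ => hα.apply_eq_zero hba fun x => ?_⟩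
      by_cases hx : lam.conv g f x = 0
      · change lam.conv g f x * _ = 0
        rw [hx, zero_mul]
      · obtain ⟨t', y', ht', -, hty', rfl⟩ := lam.exists_of_conv_ne_zero hx
        rw [𝒢.r_mul _ _ hty', hbM _ (hg ht'), mul_zero]
  -- If `t` and `y` are not composable, neither are nearby points, and the convolution is
  -- identically zero.
  · obtain ⟨M, N, hM, hN, htM, hyN, hd⟩ := t2_separation hty
    refine ⟨𝒢.s ⁻¹' M, 𝒢.r ⁻¹' N, hM.preimage 𝒢.continuous_s, hN.preimage 𝒢.continuous_r,
      htM, hyN, fun g f hg hf => ?_⟩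
    have h0 : lam.conv g f = 0 := by
      funext x
      by_contra hx
      obtain ⟨t', y', ht', hy', hty', -⟩ := lam.exists_of_conv_ne_zero hx
      refine Set.disjoint_left.1 hd (hg ht') ?_
      rw [hty']
      exact hf hy'
    have h1 : (⟨_, lam.conv_mem_fourierAlgebra g f⟩ : lam.fourierAlgebra) = 0 := Subtype.ext h0
    rw [h1, map_zero]
    rfl

variable [LocallyCompactSpace G] [BorelSpace G]

/-- The additive functional `g ↦ α (g * f) a`. -/
noncomputable def convFunctionalLeft (α : lam.fourierAlgebra →ₗ[ℂ] C₀(X, ℂ)) (a : X) (f : C_c(G, ℂ)) :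
    C_c(G, ℂ) →+ ℂ :=
  AddMonoidHom.mk' (fun g => α ⟨_, lam.conv_mem_fourierAlgebra g f⟩ a) fun g g' => by
    have h1 : (⟨_, lam.conv_mem_fourierAlgebra (g + g') f⟩ : lam.fourierAlgebra) =
        ⟨_, lam.conv_mem_fourierAlgebra g f⟩ + ⟨_, lam.conv_mem_fourierAlgebra g' f⟩ :=
      Subtype.ext (lam.conv_add_left g g' f)
    rw [h1, map_add, ZeroAtInftyContinuousMap.add_apply]

/-- The additive functional `f ↦ α (g * f) a`. -/
noncomputable def convFunctionalRight (α : lam.fourierAlgebra →ₗ[ℂ] C₀(X, ℂ)) (a : X) (g : C_c(G, ℂ)) :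
    C_c(G, ℂ) →+ ℂ :=
  AddMonoidHom.mk' (fun f => α ⟨_, lam.conv_mem_fourierAlgebra g f⟩ a) fun f f' => by
    have h1 : (⟨_, lam.conv_mem_fourierAlgebra g (f + f')⟩ : lam.fourierAlgebra) =
        ⟨_, lam.conv_mem_fourierAlgebra g f⟩ + ⟨_, lam.conv_mem_fourierAlgebra g f'⟩ :=
      Subtype.ext (lam.conv_add_right g f f')
    rw [h1, map_add, ZeroAtInftyContinuousMap.add_apply]

/-- The neighborhoods of `t` given by `exists_nhds_conv_eq_zero` depend on `y`. Compactness of the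
support of `f` reduces them to finitely many, whose intersection serves every piece of `f` at once;
the support principle then applies in `f` and afterwards in `g`. -/
theorem IsRightModuleMap.conv_eq_zero (hα : lam.IsRightModuleMap α) {a : X}
    (h : ∀ x, 𝒢.r x = a → x ∉ lam.rCarrier α) (g f : C_c(G, ℂ)) :
    α ⟨_, lam.conv_mem_fourierAlgebra g f⟩ a = 0 := by
  refine CompactlySupportedContinuousMap.map_eq_zero_of_locally (convFunctionalLeft α a f) g
    fun t _ => ?_
  choose U W hU hW htU hyW hUW using fun y => hα.exists_nhds_conv_eq_zero h t y
  obtain ⟨F, hF⟩ := f.hasCompactSupport.isCompact.elim_finite_subcover W hW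
    fun y _ => Set.mem_iUnion.2 ⟨y, hyW y⟩
  refine ⟨⋂ y ∈ F, U y, isOpen_biInter_finset fun y _ => hU y, Set.mem_iInter₂.2 fun y _ => htU y,
    fun g' hg' => ?_⟩
  refine CompactlySupportedContinuousMap.map_eq_zero_of_locally (convFunctionalRight α a g') f
    fun z hz => ?_
  obtain ⟨y, hyF, hzy⟩ := Set.mem_iUnion₂.1 (hF hz)
  exact ⟨W y, hW y, hzy, fun f' hf' =>
    hUW y g' f' (hg'.trans (Set.biInter_subset_of_mem hyF)) hf'⟩

/-- A bounded multiplicative right module map that is nonzero at `a` has a carrier point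
in `G^a`. -/
theorem IsRightModuleMap.exists_mem_rCarrier (hα : lam.IsRightModuleMap α)
    (hb : lam.IsBoundedMap α) (hm : lam.IsMultiplicative α) {a : X}
    (h : ∃ φ : lam.fourierAlgebra, α φ a ≠ 0) : ∃ x, 𝒢.r x = a ∧ x ∈ lam.rCarrier α := by
  by_contra! hne
  obtain ⟨φ, hφ⟩ := h
  exact hφ (hm.apply_eq_zero_of_conv hb (hα.conv_eq_zero hne) φ)

end Functionals

end HaarSystem

/-! ### Assembly of the bisection. -/

theorem proposition25 {G : Type u} {X : Type v}
    [TopologicalSpace G] [T2Space G] [LocallyCompactSpace G] [SecondCountableTopology G]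
    [MeasurableSpace G] [BorelSpace G]
    [TopologicalSpace X] [T2Space X] [LocallyCompactSpace X] [SecondCountableTopology X]
    (𝒢 : TopGroupoid G X) (lam : HaarSystem 𝒢)
    (α β : lam.fourierAlgebra →ₗ[ℂ] C₀(X, ℂ)) (h : lam.IsMultiplicativeModuleMap α β) :
    ∃ γ δ : X → G, lam.IsRSectionOf α γ ∧ lam.IsSSectionOf β δ ∧
      ∃ B : Set G, 𝒢.IsBisection B ∧ Set.range γ = B ∧ Set.range δ = B ∧
        (∃ e : B ≃ₜ X, (∀ x : B, e x = 𝒢.r x) ∧ ∀ a : X, γ a = e.symm a) ∧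
        (∃ e : B ≃ₜ X, (∀ x : B, e x = 𝒢.s x) ∧ ∀ a : X, δ a = e.symm a) := by
  obtain ⟨J, hJ⟩ := h.exists_homeo
  have hα := h.multiplicative
  have hβ : lam.IsMultiplicative β := hα.of_homeo hJ
  choose γ hγr hγ using fun a =>
    h.rightModule.exists_mem_rCarrier h.bounded_left hα (h.nonzero a)
  have hγV : ∀ (a : X) (V : Set G), IsOpen V → γ a ∈ V →
      ∃ φ : lam.fourierAlgebra, (φ : G → ℂ) ∈ lam.AcfOn V ∧ α φ a ≠ 0 := by
    intro a V hV ha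
    have := hγ a V hV ha
    rwa [hγr] at this
  have hγβ : ∀ (a : X) (V : Set G), IsOpen V → γ a ∈ V →
      ∃ φ : lam.fourierAlgebra, (φ : G → ℂ) ∈ lam.AcfOn V ∧ β φ (J a) ≠ 0 := by
    simpa only [hJ] using hγV
  -- Near `γ a` there are functions on which `β` is nonzero at `J a`, which a left module map allows
  -- only in the `s`-fiber over `J a`.
  have hγs : ∀ a, 𝒢.s (γ a) = J a := fun a => h.leftModule.s_eq (hγβ a)
  have hγc : Continuous γ := by
    refine continuous_iff_continuousAt.2 fun a => (nhds_basis_opens (γ a)).tendsto_right_iff.2 ?_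
    rintro V ⟨haV, hV⟩
    obtain ⟨φ, hφ, hφa⟩ := hγV a V hV haV
    -- For `c` near `a` still `α φ c ≠ 0`, so `γ c` lies in the support of this one `φ`, hence in
    -- `V`.
    filter_upwards [(α φ).continuous.continuousAt.eventually_ne hφa] with c hc
    exact hφ.2 (hα.mem_tsupport_of_ne_zero (hγV c) hc)
  have hδs : ∀ a, 𝒢.s (γ (J.symm a)) = a := fun a => by rw [hγs, J.apply_symm_apply]
  have hδc : Continuous fun a => γ (J.symm a) := hγc.comp J.symm.continuous
  have hδrange : Set.range (fun a => γ (J.symm a)) = Set.range γ :=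
    J.symm.surjective.range_comp γ
  have hr := exists_homeomorph_range 𝒢.continuous_r hγc hγr rfl
  have hs := exists_homeomorph_range 𝒢.continuous_s hδc hδs hδrange
  -- With `δ = γ ∘ J⁻¹` the ranges agree because `J` is a bijection, and `r`, `s` are continuous
  -- left inverses of `γ`, `δ`.
  refine ⟨γ, fun a => γ (J.symm a), fun a => ?_, fun a => ?_, Set.range γ, ⟨?_, ?_⟩, rfl, hδrange,
    hr, hs⟩
  · refine Set.eq_singleton_iff_unique_mem.2 ⟨⟨hγ a, hγr a⟩, ?_⟩
    rintro x ⟨hx, rfl⟩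
    exact hα.carrier_subsingleton hx (hγV _)
  · have hmem : ∀ V : Set G, IsOpen V → γ (J.symm a) ∈ V →
        ∃ φ : lam.fourierAlgebra, (φ : G → ℂ) ∈ lam.AcfOn V ∧ β φ a ≠ 0 := by
      simpa only [J.apply_symm_apply] using hγβ (J.symm a)
    refine Set.eq_singleton_iff_unique_mem.2 ⟨⟨?_, hδs a⟩, ?_⟩
    · intro V hV ha
      rw [hδs]
      exact hmem V hV ha
    · rintro x ⟨hx, rfl⟩
      exact hβ.carrier_subsingleton hx hmem
  · obtain ⟨e, -, he⟩ := hr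
    refine ⟨e.symm, fun a => ?_⟩
    rw [← he]
    exact inter_fiber_eq_singleton hγr a
  · obtain ⟨e, -, he⟩ := hs
    refine ⟨e.symm, fun a => ?_⟩
    rw [← he, ← hδrange]
    exact inter_fiber_eq_singleton hδs a
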